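/- An ideal on $\mathbb N_0$ is a non-empty family $\mathcal I$ of subsets of $\mathbb N_0$ that is closed under taking subsets and finite unions. It is analytic if, as a subset of $\{0,1\}^{\mathbb N_0}$ with the product topology (a subset of $\mathbb N_0$ being identified with its indicator function), it is an analytic set. It is a $P$-ideal if for every sequence $(I_n)$ of members of $\mathcal I$ there is $I\in\mathcal I$ such that $I_n\setminus I$ is finite for all $n$. A sequence $(x_n)_{n\in\mathbb N_0}$ in a topological space $\mathcal I$-converges to $x$ if $\{n\in\mathbb N_0 : x_n\notin U\}\in\mathcal I$ for every neighbourhood $U$ of $x$. **Theorem.** Let $\mathcal I$ be an analytic $P$-ideal on $\mathbb N_0$, let $K$ be a compact abelian topological group, and let $u=(u_n)_{n\in\mathbb N_0}$ be a sequence in its dual $K^\wedge$, the discrete group of continuous homomorphisms $K\to\mathbb T=\mathbb R/\mathbb Z$. Then $$s^{\mathcal I}_u(K)=\{\chi\in K : (u_n(\chi))_n \ \mathcal I\text{-converges to } 0 \text{ in } \mathbb T\}$$ is an $F_{\sigma\delta}$-subset of $K$ (a countable intersection of countable unions of closed sets); in particular it is a Borel subset of $K$. -/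

import Mathlib

open Topology

/-- `x` is `I`-convergent to `a`: for every neighbourhood `U` of `a`, the set of indices `n` with
`x n ∉ U` belongs to the ideal `I`. An ideal on `ℕ` is an order ideal of `Set ℕ`: a nonempty family
of subsets of `ℕ` that is closed under subsets and finite unions. -/
def IdealConverges {X : Type*} [TopologicalSpace X] (I : Order.Ideal (Set ℕ))
    (x : ℕ → X) (a : X) : Prop :=
  ∀ U ∈ 𝓝 a, {n : ℕ | x n ∉ U} ∈ I

/-- `I` is a P-ideal: every sequence of members of `I` has a pseudo-union in `I`. -/
def IsPIdeal (I : Order.Ideal (Set ℕ)) : Prop :=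
  ∀ A : ℕ → Set ℕ, (∀ n, A n ∈ I) → ∃ B ∈ I, ∀ n, (A n \ B).Finite

/-- `I` is analytic: under the identification of a subset of `ℕ` with its indicator function, it is
an analytic subset of `{0,1}^ℕ` with the product topology. -/
def IsAnalyticIdeal (I : Order.Ideal (Set ℕ)) : Prop :=
  MeasureTheory.AnalyticSet {f : ℕ → Bool | {n : ℕ | f n = true} ∈ I}

/-- The (underlying set of the) Pontryagin dual of an abelian topological group `K`: the
continuous homomorphisms from `K` to `𝕋 = ℝ / ℤ`. -/
abbrev CharacterGroup (K : Type*) [AddCommGroup K] [TopologicalSpace K] : Type _ :=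
  K →ₜ+ UnitAddCircle

/-- The set `s_u^I(K)` of those `x` in `K` for which `u n x` is `I`-convergent to `0` in `𝕋`. -/
def idealCharacterized {K : Type*} [AddCommGroup K] [TopologicalSpace K]
    (I : Order.Ideal (Set ℕ)) (u : ℕ → CharacterGroup K) : Set K :=
  {x : K | IdealConverges I (fun n => u n x) 0}

/-- `S` is an `F_σδ`-set: a countable intersection of countable unions of closed sets. -/
def IsFSigmaDelta {X : Type*} [TopologicalSpace X] (S : Set X) : Prop :=
  ∃ F : ℕ → ℕ → Set X, (∀ m n, IsClosed (F m n)) ∧ S = ⋂ m, ⋃ n, F m n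

/-! Convergence to `0` says that countably many sets `{n | 1/(j+1) < ‖u n x‖}` lie in `I`. They are
cut out by open conditions on `x`, so closed hereditary families pull back to closed sets, and it
suffices to write `I` as a countable intersection of countable unions of such families. Parametrize
`I` by the Baire space via `f` and keep the set `P` of points near which `f` is always almost
cofinal; the P-ideal property makes `P` rich. Members of `I` are then approximated, past some `m`,
by values of `f` in every cylinder meeting `P`; conversely, `exists_cover_by_two_values` turns such
approximations into membership. -/

/-- A family of subsets of `ℕ` is closed and hereditary: it is closed under taking subsets, and a set
belongs to it as soon as all its initial segments do. -/
def IsClosedHereditary (C : Set (Set ℕ)) : Prop :=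
  IsLowerSet C ∧ ∀ A : Set ℕ, (∀ n, A ∩ Set.Iio n ∈ C) → A ∈ C

/-- `S` is cofinal in `I` with respect to inclusion modulo finite sets. -/
def IsAlmostCofinal (I S : Set (Set ℕ)) : Prop :=
  ∀ A ∈ I, ∃ B ∈ S, (A \ B).Finite

theorem Order.Ideal.finite_mem {I : Order.Ideal (Set ℕ)} {A : Set ℕ} (hA : A.Finite)
    (h : ∀ i ∈ A, {i} ∈ I) : A ∈ I := by
  induction A, hA using Set.Finite.induction_on with
  | empty => exact I.bot_mem
  | @insert a s _ _ ih =>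
    rw [Set.insert_eq]
    exact I.sup_mem (h a (Set.mem_insert _ _))
      (ih fun i hi => h i (Set.mem_insert_of_mem _ hi))

/-- Countably many families that are not almost cofinal do not cover an almost cofinal family. -/
theorem IsPIdeal.exists_isAlmostCofinal {I : Order.Ideal (Set ℕ)} (hP : IsPIdeal I)
    {ι : Type*} [Countable ι] {S : Set (Set ℕ)} (hS : IsAlmostCofinal I S)
    (T : ι → Set (Set ℕ)) (hT : S ⊆ ⋃ i, T i) : ∃ i, IsAlmostCofinal I (T i) := by
  by_contra! hcon
  have h : ∀ i, ∃ A ∈ I, ∀ B ∈ T i, ¬ (A \ B).Finite := by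
    intro i
    have := hcon i
    unfold IsAlmostCofinal at this
    push Not at this
    simpa using this
  choose A hAI hA using h
  obtain hι | hι := isEmpty_or_nonempty ι
  · obtain ⟨B, hB, -⟩ := hS ∅ I.bot_mem
    simpa using hT hB
  obtain ⟨e, he⟩ := exists_surjective_nat ι
  -- A set almost containing the pseudo-union `X` almost contains every witness `A i`, so it lies in
  -- no `T i`.
  obtain ⟨X, hX, hAX⟩ := hP (fun n => A (e n)) fun n => hAI _
  obtain ⟨B, hB, hXB⟩ := hS X hX
  obtain ⟨i, hi⟩ := Set.mem_iUnion.1 (hT hB)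
  obtain ⟨n, rfl⟩ := he i
  refine hA _ B hi (((hAX n).union hXB).subset ?_)
  intro a ha
  by_cases haX : a ∈ X
  · exact Or.inr ⟨haX, ha.2⟩
  · exact Or.inl ⟨ha.1, haX⟩

/-- The basic open subset of the Baire space given by a finite sequence, written in reverse. -/
def baireCylinder (s : List ℕ) : Set (ℕ → ℕ) :=
  {x | PiNat.res x s.length = s}

theorem mem_baireCylinder_res {x y : ℕ → ℕ} {l : ℕ} :
    y ∈ baireCylinder (PiNat.res x l) ↔ y ∈ PiNat.cylinder x l := by
  rw [PiNat.cylinder_eq_res]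
  simp [baireCylinder]

/-- The points of the Baire space all of whose neighbourhoods have an almost cofinal image. -/
def cofinalPoints (I : Set (Set ℕ)) (f : (ℕ → ℕ) → Set ℕ) : Set (ℕ → ℕ) :=
  {x | ∀ l, IsAlmostCofinal I (f '' PiNat.cylinder x l)}

/-- The discarded points lie in countably many cylinders with non-cofinal image, so the remaining
piece must be cofinal. -/
theorem isAlmostCofinal_image_inter_cofinalPoints {I : Order.Ideal (Set ℕ)} (hP : IsPIdeal I)
    (f : (ℕ → ℕ) → Set ℕ) {V : Set (ℕ → ℕ)} (hV : IsAlmostCofinal I (f '' V)) :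
    IsAlmostCofinal I (f '' (V ∩ cofinalPoints I f)) := by
  let T : Option {s : List ℕ // ¬ IsAlmostCofinal I (f '' baireCylinder s)} → Set (Set ℕ) :=
    fun o => o.elim (f '' (V ∩ cofinalPoints I f)) fun s => f '' baireCylinder s.1
  obtain ⟨o, ho⟩ := hP.exists_isAlmostCofinal hV T (by
    rintro _ ⟨x, hx, rfl⟩
    rw [Set.mem_iUnion]
    by_cases hxP : x ∈ cofinalPoints I f
    · exact ⟨none, x, ⟨hx, hxP⟩, rfl⟩
    · simp only [cofinalPoints, Set.mem_ofPred_eq, not_forall] at hxP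
      obtain ⟨l, hl⟩ := hxP
      have hc : baireCylinder (PiNat.res x l) = PiNat.cylinder x l :=
        Set.ext fun y => mem_baireCylinder_res
      refine ⟨some ⟨PiNat.res x l, by rwa [hc]⟩, x, ?_, rfl⟩
      change x ∈ baireCylinder (PiNat.res x l)
      rw [hc]
      exact PiNat.self_mem_cylinder x l)
  rcases o with _ | s
  · exact ho
  · exact absurd ho s.2

theorem exists_mem_iInter_cylinder (x : ℕ → ℕ → ℕ) (l : ℕ → ℕ) (hl : ∀ j, l j < l (j + 1))
    (hx : ∀ j, x (j + 1) ∈ PiNat.cylinder (x j) (l j)) :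
    ∃ z, ∀ j, z ∈ PiNat.cylinder (x j) (l j) := by
  have hmono : StrictMono l := strictMono_nat_of_lt_succ hl
  have hstep : ∀ j k, ∀ i < l j, x (j + k) i = x j i := by
    intro j k
    induction k with
    | zero => intro i _; rfl
    | succ k ih =>
      intro i hi
      rw [← ih i hi]
      exact hx (j + k) i (hi.trans_le (hmono.monotone (Nat.le_add_right j k)))
  refine ⟨fun i => x (i + 1) i, fun j i hi => ?_⟩
  have hi' : i < l (i + 1) := (Nat.lt_succ_self i).trans_le hmono.le_apply
  change x (i + 1) i = x j i
  rcases le_total j (i + 1) with h | h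
  · obtain ⟨k, hk⟩ := Nat.exists_eq_add_of_le h
    rw [hk, hstep j k i hi]
  · obtain ⟨k, rfl⟩ := Nat.exists_eq_add_of_le h
    rw [hstep (i + 1) k i hi']

/-- If final segments of `A` are locally approximated near every point of `P` by values of `f`, then
a final segment of `A` is covered by two values of `f`. -/
theorem exists_cover_by_two_values {f : (ℕ → ℕ) → Set ℕ}
    (hf : ∀ i, IsOpen {x | i ∈ f x}) {P : Set (ℕ → ℕ)} (hPne : P.Nonempty) {A : Set ℕ}
    (hA : ∀ x ∈ P, ∀ l, ∃ m, ∀ n, ∃ y ∈ PiNat.cylinder x l ∩ P, A ∩ Set.Ico m n ⊆ f y) :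
    ∃ x y m, A ∩ Set.Ici m ⊆ f x ∪ f y := by
  -- Covering a finite set is an open condition on the point, so it holds on a whole cylinder. The
  -- bound `p.2 ≤ m` sends the thresholds to infinity.
  have hm : ∀ p : P × ℕ, ∃ m, p.2 ≤ m ∧ ∀ n, ∃ q : P × ℕ, p.2 < q.2 ∧
      q.1.1 ∈ PiNat.cylinder p.1.1 p.2 ∧ ∀ z ∈ PiNat.cylinder q.1.1 q.2,
        A ∩ Set.Ico m n ⊆ f z := by
    rintro ⟨⟨x, hx⟩, l⟩
    obtain ⟨m, hm⟩ := hA x hx l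
    refine ⟨max m l, le_max_right _ _, fun n => ?_⟩
    obtain ⟨y, ⟨hyc, hyP⟩, hy⟩ := hm n
    have hopen : IsOpen (⋂ i ∈ A ∩ Set.Ico m n, {z | i ∈ f z}) :=
      ((Set.finite_Ico m n).subset Set.inter_subset_right).isOpen_biInter fun i _ => hf i
    have hmem : y ∈ ⋂ i ∈ A ∩ Set.Ico m n, {z | i ∈ f z} :=
      Set.mem_iInter₂.2 fun i hi => hy hi
    obtain ⟨_, ⟨w, k, rfl⟩, hyw, hsub⟩ :=
      (PiNat.isTopologicalBasis_cylinders (fun _ : ℕ => ℕ)).exists_subset_of_mem_open hmem hopen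
    rw [← PiNat.mem_cylinder_iff_eq.1 hyw] at hsub
    refine ⟨⟨⟨y, hyP⟩, max k (l + 1)⟩, ?_, hyc, fun z hz i hi => ?_⟩
    · exact (Nat.lt_succ_self l).trans_le (le_max_right _ _)
    · exact Set.mem_iInter₂.1 (hsub (PiNat.cylinder_anti y (le_max_left _ _) hz)) i
        ⟨hi.1, (le_max_left _ _).trans hi.2.1, hi.2.2⟩
  choose m hlm next hlt hcyl hcov using hm
  obtain ⟨x₀, hx₀⟩ := hPne
  -- A new threshold is known only after its point is chosen, leaving a gap. Two branches alternate,
  -- each covering up to the other's current threshold.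
  let step : (P × ℕ) × (P × ℕ) → (P × ℕ) × (P × ℕ) := fun r =>
    (next r.1 (m r.2), next r.2 (m (next r.1 (m r.2))))
  let r : ℕ → (P × ℕ) × (P × ℕ) := fun j => step^[j] ((⟨x₀, hx₀⟩, 0), (⟨x₀, hx₀⟩, 0))
  have hr : ∀ j, r (j + 1) = step (r j) := fun j => Function.iterate_succ_apply' _ _ _
  have hr1 : ∀ j, (r (j + 1)).1 = next (r j).1 (m (r j).2) := fun j => by rw [hr]
  have hr2 : ∀ j, (r (j + 1)).2 = next (r j).2 (m (r (j + 1)).1) := fun j => by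
    rw [hr1, hr]
  have hl1 : ∀ j, (r j).1.2 < (r (j + 1)).1.2 := fun j => by rw [hr1]; exact hlt _ _
  have hl2 : ∀ j, (r j).2.2 < (r (j + 1)).2.2 := fun j => by rw [hr2]; exact hlt _ _
  obtain ⟨x, hx⟩ := exists_mem_iInter_cylinder (fun j => (r j).1.1.1) (fun j => (r j).1.2) hl1
    fun j => by rw [hr1]; exact hcyl _ _
  obtain ⟨y, hy⟩ := exists_mem_iInter_cylinder (fun j => (r j).2.1.1) (fun j => (r j).2.2) hl2
    fun j => by rw [hr2]; exact hcyl _ _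
  refine ⟨x, y, m (r 0).1, ?_⟩
  rintro i ⟨hiA, hi⟩
  have hex : ∃ j, i < m (r j).1 :=
    ⟨i + 1, ((Nat.lt_succ_self i).trans_le
      (strictMono_nat_of_lt_succ hl1).le_apply).trans_le (hlm _)⟩
  classical
  obtain ⟨j, hj⟩ : ∃ j, Nat.find hex = j + 1 := by
    refine Nat.exists_eq_succ_of_ne_zero fun h0 => ?_
    have := Nat.find_spec hex
    rw [h0] at this
    exact absurd this (not_lt.2 hi)
  have hlow : m (r j).1 ≤ i := not_lt.1 (Nat.find_min hex (by omega))
  have hup : i < m (r (j + 1)).1 := hj ▸ Nat.find_spec hex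
  rcases lt_or_ge i (m (r j).2) with h | h
  · refine Or.inl (hcov (r j).1 (m (r j).2) x ?_ ⟨hiA, hlow, h⟩)
    rw [← hr1]
    exact hx (j + 1)
  · refine Or.inr (hcov (r j).2 (m (r (j + 1)).1) y ?_ ⟨hiA, h, hup⟩)
    rw [← hr2]
    exact hy (j + 1)

/-- A form of Solecki's theorem: an analytic P-ideal is a countable intersection of countable unions
of closed hereditary families. -/
theorem IsAnalyticIdeal.exists_isClosedHereditary {I : Order.Ideal (Set ℕ)}
    (hI : IsAnalyticIdeal I) (hP : IsPIdeal I) :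
    ∃ C : List ℕ → ℕ → Set (Set ℕ), (∀ s m, IsClosedHereditary (C s m)) ∧
      ∀ A, A ∈ I ↔ ∀ s, ∃ m, A ∈ C s m := by
  obtain ⟨f, hfI, hf⟩ : ∃ f : (ℕ → ℕ) → Set ℕ, (∀ A, A ∈ I ↔ ∃ x, f x = A) ∧
      ∀ i, IsOpen {x | i ∈ f x} := by
    classical
    rw [IsAnalyticIdeal, MeasureTheory.AnalyticSet] at hI
    rcases hI with hI | ⟨g, hg, hgI⟩
    · exfalso
      have : (fun _ => false) ∈ {f : ℕ → Bool | {n : ℕ | f n = true} ∈ I} := by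
        simpa using I.bot_mem
      simp [hI] at this
    · refine ⟨fun x => {n | g x n = true}, fun A => ⟨fun hA => ?_, ?_⟩, fun i => ?_⟩
      · have : (fun n => decide (n ∈ A)) ∈ Set.range g := by
          rw [hgI]
          simpa using hA
        obtain ⟨x, hx⟩ := this
        exact ⟨x, by simp [hx]⟩
      · rintro ⟨x, rfl⟩
        have : g x ∈ Set.range g := ⟨x, rfl⟩
        rw [hgI] at this
        exact this
      · exact (isOpen_discrete ({true} : Set Bool)).preimage ((continuous_apply i).comp hg)
  set P := cofinalPoints I f with hPdef
  have hcofinal {V : Set (ℕ → ℕ)} (hV : IsAlmostCofinal I (f '' V)) :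
      IsAlmostCofinal I (f '' (V ∩ P)) := isAlmostCofinal_image_inter_cofinalPoints hP f hV
  have hPne : P.Nonempty := by
    obtain ⟨_, ⟨x, hx, -⟩, -⟩ := hcofinal (V := Set.univ) (fun A hA => by
      obtain ⟨x, rfl⟩ := (hfI A).1 hA
      exact ⟨f x, ⟨x, trivial, rfl⟩, by simp⟩) ∅ I.bot_mem
    exact ⟨x, hx.2⟩
  -- The singleton clause handles the part of `A` below `m`, which the intervals ignore.
  refine ⟨fun s m => {A | (∀ i ∈ A, {i} ∈ I) ∧ ((baireCylinder s ∩ P).Nonempty →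
    ∀ n, ∃ y ∈ baireCylinder s ∩ P, A ∩ Set.Ico m n ⊆ f y)}, fun s m => ⟨?_, ?_⟩, fun A => ⟨?_, ?_⟩⟩
  · rintro A B hBA ⟨hA, hA'⟩
    refine ⟨fun i hi => hA i (hBA hi), fun hne n => ?_⟩
    obtain ⟨y, hy, hyA⟩ := hA' hne n
    exact ⟨y, hy, (Set.inter_subset_inter_left _ hBA).trans hyA⟩
  · refine fun A hA => ⟨fun i hi => (hA (i + 1)).1 i ⟨hi, Nat.lt_succ_self i⟩, fun hne n => ?_⟩
    obtain ⟨y, hy, hyA⟩ := (hA n).2 hne n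
    exact ⟨y, hy, fun i hi => hyA ⟨⟨hi.1, hi.2.2⟩, hi.2⟩⟩
  · intro hA s
    have hsing : ∀ i ∈ A, {i} ∈ I := fun i hi => I.lower (Set.singleton_subset_iff.2 hi) hA
    by_cases hne : (baireCylinder s ∩ P).Nonempty
    · obtain ⟨x, hxs, hxP⟩ := hne
      have hs : baireCylinder s = PiNat.cylinder x s.length := by
        ext z
        rw [← mem_baireCylinder_res, show PiNat.res x s.length = s from hxs]
      obtain ⟨_, ⟨y, hy, rfl⟩, hfin⟩ := hcofinal (hxP s.length) A hA
      obtain ⟨m, hm⟩ := hfin.bddAbove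
      refine ⟨m + 1, hsing, fun _ n => ⟨y, by rwa [hs], fun i hi => ?_⟩⟩
      by_contra hiy
      exact absurd (hm ⟨hi.1, hiy⟩) (not_le.2 hi.2.1)
    · exact ⟨0, hsing, fun h => absurd h hne⟩
  · intro hA
    obtain ⟨x, y, m, hxy⟩ := exists_cover_by_two_values hf hPne (A := A) fun x hx l => by
      obtain ⟨m, -, hm⟩ := hA (PiNat.res x l)
      have hc : baireCylinder (PiNat.res x l) = PiNat.cylinder x l :=
        Set.ext fun y => mem_baireCylinder_res
      rw [hc] at hm
      exact ⟨m, hm ⟨x, PiNat.self_mem_cylinder x l, hx⟩⟩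
    have hsing : ∀ i ∈ A, {i} ∈ I := by
      obtain ⟨_, h, -⟩ := hA []
      exact h
    have h1 : A ∩ Set.Iio m ∈ I :=
      Order.Ideal.finite_mem ((Set.finite_Iio m).subset Set.inter_subset_right)
        fun i hi => hsing i hi.1
    have h2 : f x ∪ f y ∈ I := I.sup_mem ((hfI _).2 ⟨x, rfl⟩) ((hfI _).2 ⟨y, rfl⟩)
    refine I.lower ?_ (I.sup_mem h1 h2)
    intro i hi
    rcases lt_or_ge i m with h | h
    · exact Or.inl ⟨hi, h⟩
    · exact Or.inr (hxy ⟨hi, h⟩)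

/-- Non-membership is witnessed by a finite initial segment, which can only grow near `x`. -/
theorem IsClosedHereditary.isClosed_setOf {X : Type*} [TopologicalSpace X] {C : Set (Set ℕ)}
    (hC : IsClosedHereditary C) {V : ℕ → Set X} (hV : ∀ n, IsOpen (V n)) :
    IsClosed {x | {n | x ∈ V n} ∈ C} := by
  have h : {x | {n | x ∈ V n} ∈ C} = ⋂ k, {x | {n | x ∈ V n} ∩ Set.Iio k ∈ C} := by
    ext x
    simp only [Set.mem_ofPred_eq, Set.mem_iInter]
    exact ⟨fun hx k => hC.1 Set.inter_subset_left hx, hC.2 _⟩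
  rw [h]
  refine isClosed_iInter fun k => ⟨isOpen_iff_mem_nhds.2 fun x hx => ?_⟩
  have hfin : ({n | x ∈ V n} ∩ Set.Iio k).Finite :=
    (Set.finite_Iio k).subset Set.inter_subset_right
  have hnhds : (⋂ n ∈ {n | x ∈ V n} ∩ Set.Iio k, V n) ∈ 𝓝 x :=
    (Filter.biInter_mem hfin).2 fun n hn => (hV n).mem_nhds hn.1
  refine Filter.mem_of_superset hnhds fun y hy hyC => hx (hC.1 ?_ hyC)
  exact fun n hn => ⟨Set.mem_iInter₂.1 hy n hn, hn.2⟩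

theorem isFSigmaDelta_iInter_iUnion {X ι : Type*} [TopologicalSpace X] [Countable ι] [Nonempty ι]
    {F : ι → ℕ → Set X} (hF : ∀ i n, IsClosed (F i n)) : IsFSigmaDelta (⋂ i, ⋃ n, F i n) := by
  obtain ⟨e, he⟩ := exists_surjective_nat ι
  exact ⟨fun m n => F (e m) n, fun m n => hF _ _, (he.iInter_comp fun i => ⋃ n, F i n).symm⟩

theorem IsFSigmaDelta.measurableSet_borel {X : Type*} [TopologicalSpace X] {S : Set X}
    (hS : IsFSigmaDelta S) : @MeasurableSet X (borel X) S := by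
  obtain ⟨F, hF, rfl⟩ := hS
  borelize X
  exact MeasurableSet.iInter fun m => MeasurableSet.iUnion fun n => (hF m n).measurableSet

theorem idealConverges_zero_iff {E : Type*} [SeminormedAddCommGroup E] {I : Order.Ideal (Set ℕ)}
    {x : ℕ → E} : IdealConverges I x 0 ↔ ∀ j : ℕ, {n | 1 / ((j : ℝ) + 1) < ‖x n‖} ∈ I := by
  constructor
  · intro h j
    simpa using h _ (Metric.closedBall_mem_nhds (0 : E) (Nat.one_div_pos_of_nat (n := j)))
  · intro h U hU
    obtain ⟨ε, hε, hU⟩ := Metric.mem_nhds_iff.1 hU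
    obtain ⟨j, hj⟩ := exists_nat_one_div_lt hε
    refine I.lower (fun n hn => ?_) (h j)
    by_contra hlt
    exact hn (hU (mem_ball_zero_iff.2 ((not_lt.1 hlt).trans_lt hj)))

theorem mainTheorem2 (I : Order.Ideal (Set ℕ)) (hI : IsAnalyticIdeal I) (hP : IsPIdeal I)
    {K : Type*} [AddCommGroup K] [TopologicalSpace K] [IsTopologicalAddGroup K] [CompactSpace K]
    (u : ℕ → CharacterGroup K) :
    IsFSigmaDelta (idealCharacterized I u) ∧
      @MeasurableSet K (borel K) (idealCharacterized I u) := by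
  obtain ⟨C, hC, hCI⟩ := hI.exists_isClosedHereditary hP
  have key : IsFSigmaDelta (idealCharacterized I u) := by
    have h : idealCharacterized I u = ⋂ p : ℕ × List ℕ, ⋃ m,
        {x : K | {n | x ∈ {x : K | 1 / ((p.1 : ℝ) + 1) < ‖u n x‖}} ∈ C p.2 m} := by
      ext x
      simp [idealCharacterized, idealConverges_zero_iff, hCI]
    rw [h]
    refine isFSigmaDelta_iInter_iUnion fun p m => (hC p.2 m).isClosed_setOf fun n => ?_
    exact isOpen_lt continuous_const (map_continuous (u n)).norm
  exact ⟨key, key.measurableSet_borel⟩
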